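/- Let $R$ be a unital associative ring, $\mathrm{Mod}\,R$ the category of right $R$-modules and $\mathcal D(\mathrm{Mod}\,R)$ its derived category. All subcategories are full and closed under isomorphisms. A torsion pair in $\mathrm{Mod}\,R$ is a pair $(\mathcal T,\mathcal F)$ of such subcategories with $\mathrm{Hom}_R(T,F)=0$ for all $T\in\mathcal T$, $F\in\mathcal F$, and such that every module $X$ admits a short exact sequence $0\to T\to X\to F\to 0$ with $T\in\mathcal T$ and $F\in\mathcal F$. The heart of its HRS-tilt is the full subcategory $\mathcal H=\mathcal U[-1]\cap\mathcal V$ of $\mathcal D(\mathrm{Mod}\,R)$, where $$\mathcal U=\{X \mid H^0(X)\in\mathcal T,\ H^i(X)=0 \text{ for } i>0\},\qquad \mathcal V=\{X \mid H^0(X)\in\mathcal F,\ H^i(X)=0\text{ for } i<0\}.$$ A non-zero module $T$ is called almost torsion-free if every proper submodule of $T$ lies in $\mathcal F$ and, for every short exact sequence $0\to A\to B\to T\to 0$ with $B\in\mathcal T$, also $A\in\mathcal T$. A non-zero module $F$ is called almost torsion if every proper quotient of $F$ (that is, every $F/N$ with $0\neq N\subseteq F$) lies in $\mathcal T$ and,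 for every short exact sequence $0\to F\to A\to B\to 0$ with $A\in\mathcal F$, also $B\in\mathcal F$. **Theorem 3.5.** Let $(\mathcal T,\mathcal F)$ be a torsion pair in $\mathrm{Mod}\,R$. An object $S$ of $\mathcal D(\mathrm{Mod}\,R)$ lies in $\mathcal H$ and is a simple object of $\mathcal H$ if and only if $S\cong T[-1]$ for some almost torsion-free module $T\in\mathcal T$, or $S\cong F$ for some almost torsion module $F\in\mathcal F$ (modules being regarded as complexes concentrated in degree $0$). -/

import Mathlib

open CategoryTheory CategoryTheory.Limits

universe w v u

namespace HRS

/-- A torsion pair `(T, F)` in an abelian category: two full subcategories, closed under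
isomorphisms, such that every morphism from an object of `T` to an object of `F` is zero and
every object `X` sits in a short exact sequence `0 ⟶ tX ⟶ X ⟶ X/tX ⟶ 0` with `tX` in `T` and
`X/tX` in `F`. -/
structure IsTorsionPair {C : Type u} [Category.{v} C] [Abelian C]
    (T F : ObjectProperty C) : Prop where
  torsion_iso : T.IsClosedUnderIsomorphisms
  torsionFree_iso : F.IsClosedUnderIsomorphisms
  hom_eq_zero : ∀ ⦃X Y : C⦄, T X → F Y → ∀ f : X ⟶ Y, f = 0
  exists_shortExact : ∀ X : C, ∃ (A B : C) (i : A ⟶ X) (p : X ⟶ B) (zero : i ≫ p = 0),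
    (ShortComplex.mk i p zero).ShortExact ∧ T A ∧ F B

section Heart

variable {C : Type u} [Category.{v} C] [Abelian C] [HasDerivedCategory.{w} C]

/-- The class `U` of the HRS-tilt: the objects `X` of the derived category with `H⁰(X)` in `T`
and `Hⁱ(X) = 0` for `i > 0`. -/
def aisle (T : ObjectProperty C) : ObjectProperty (DerivedCategory C) := fun X =>
  T ((DerivedCategory.homologyFunctor C 0).obj X) ∧
    ∀ i : ℤ, 0 < i → IsZero ((DerivedCategory.homologyFunctor C i).obj X)

/-- The class `V` of the HRS-tilt: the objects `X` of the derived category with `H⁰(X)` in `F`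
and `Hⁱ(X) = 0` for `i < 0`. -/
def coaisle (F : ObjectProperty C) : ObjectProperty (DerivedCategory C) := fun X =>
  F ((DerivedCategory.homologyFunctor C 0).obj X) ∧
    ∀ i : ℤ, i < 0 → IsZero ((DerivedCategory.homologyFunctor C i).obj X)

/-- The heart `U[-1] ∩ V` of the HRS-tilt of `(T, F)`, as a full subcategory of the derived
category; an object `X` lies in `U[-1]` if and only if `X[1]` lies in `U`. -/
def heart (T F : ObjectProperty C) : ObjectProperty (DerivedCategory C) := fun X =>
  aisle T (X⟦(1 : ℤ)⟧) ∧ coaisle F X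

end Heart

section Modules

variable {A : Type u} [Ring A]

/-- A module `M` is almost torsion-free (for `(T, F)`) if it is non-zero, every proper submodule
of `M` is in `F`, and for every short exact sequence `0 ⟶ X ⟶ Y ⟶ M ⟶ 0` with `Y` in `T`, also
`X` is in `T`. -/
structure IsAlmostTorsionFree (T F : ObjectProperty (ModuleCat.{v} A))
    (M : ModuleCat.{v} A) : Prop where
  nontrivial : Nontrivial M
  proper_submodule : ∀ N : Submodule A M, N ≠ ⊤ → F (ModuleCat.of A N)
  kernel : ∀ ⦃X Y : ModuleCat.{v} A⦄ (f : X ⟶ Y) (g : Y ⟶ M) (zero : f ≫ g = 0),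
    (ShortComplex.mk f g zero).ShortExact → T Y → T X

/-- A module `M` is almost torsion (for `(T, F)`) if it is non-zero, every proper quotient
of `M` is in `T`, and for every short exact sequence `0 ⟶ M ⟶ X ⟶ Y ⟶ 0` with `X` in `F`, also
`Y` is in `F`. -/
structure IsAlmostTorsion (T F : ObjectProperty (ModuleCat.{v} A))
    (M : ModuleCat.{v} A) : Prop where
  nontrivial : Nontrivial M
  proper_quotient : ∀ N : Submodule A M, N ≠ ⊥ → T (ModuleCat.of A (M ⧸ N))
  cokernel : ∀ ⦃X Y : ModuleCat.{v} A⦄ (f : M ⟶ X) (g : X ⟶ Y) (zero : f ≫ g = 0),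
    (ShortComplex.mk f g zero).ShortExact → F X → F Y

end Modules

end HRS

/-! The abelian structure of the heart is never needed: simplicity is tested on maps cancellable
against heart objects (`IsMonoOn`). Two facts carry the proof. Every heart object `X` lies in a
triangle `A ⟶ X ⟶ B[-1]` with `A` in `F` and `B` in `T` (`exists_triangle_of_heart`). There are no
non-zero maps from the heart to its shift by `-1` (`heart_hom_shift_eq_zero`), so a map whose cone
lies in the heart is a monomorphism there.

For simple `X`, the monomorphism `A ⟶ X` is zero or invertible, so `X` is `B[-1]` or `A`. Testing
simplicity on subobjects built from short exact sequences yields the almost torsion(-free)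
conditions.

Conversely, let `f : Y ⟶ M` be a non-zero monomorphism with `M` almost torsion. By the octahedral
axiom its cone is a module, an extension of `B` by the cokernel of `A ⟶ M`; it is torsion-free
because `f` is monic, and torsion once `A ⟶ M` is non-zero, hence zero. For `M[-1]`, the source of a
monomorphism is forced to be some `B[-1]`, and the question becomes one about a map `B ⟶ M`. -/

namespace HRS

/-! ### Simple objects of a full subcategory, tested in the ambient category -/

section Mono

variable {D : Type u} [Category.{v} D] [Preadditive D]

/-- A morphism is a monomorphism relative to `P` if it can be cancelled on the right of morphisms
whose source satisfies `P`. -/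
def IsMonoOn (P : ObjectProperty D) {X Y : D} (f : X ⟶ Y) : Prop :=
  ∀ ⦃Z : D⦄, P Z → ∀ g : Z ⟶ X, g ≫ f = 0 → g = 0

lemma simple_fullSubcategory_iff (P : ObjectProperty D) (S : D) (hS : P S) :
    Simple (⟨S, hS⟩ : P.FullSubcategory) ↔
      ¬ IsZero S ∧ ∀ ⦃Y : D⦄, P Y → ∀ f : Y ⟶ S, IsMonoOn P f → f ≠ 0 → IsIso f := by
  have mono_iff : ∀ {X Y : P.FullSubcategory} (f : X ⟶ Y), Mono f ↔ IsMonoOn P f.hom := by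
    intro X Y f
    rw [Preadditive.mono_iff_cancel_zero]
    constructor
    · intro h Z hZ g hg
      have := h ⟨Z, hZ⟩ (ObjectProperty.homMk g) (ObjectProperty.hom_ext _ hg)
      exact congrArg (fun k => k.hom) this
    · intro h Z g hg
      exact ObjectProperty.hom_ext _ (h Z.property g.hom (congrArg (fun k => k.hom) hg))
  constructor
  · intro hs
    refine ⟨fun hz => ?_, fun Y hY f hf h0 => ?_⟩
    · refine (Simple.mono_isIso_iff_nonzero (𝟙 (⟨S, hS⟩ : P.FullSubcategory))).1 inferInstance ?_
      exact ObjectProperty.hom_ext _ (hz.eq_of_src _ _)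
    · let f' : (⟨Y, hY⟩ : P.FullSubcategory) ⟶ ⟨S, hS⟩ := ObjectProperty.homMk f
      have : Mono f' := (mono_iff f').2 hf
      have : IsIso f' := (Simple.mono_isIso_iff_nonzero f').2
        fun h => h0 (congrArg (fun k => k.hom) h)
      exact inferInstanceAs (IsIso (P.ι.map f'))
  · rintro ⟨hz, h⟩
    refine ⟨fun {Y} f hf => ⟨fun hi h0 => hz ?_, fun h0 => ?_⟩⟩
    · have : IsIso f.hom := inferInstanceAs (IsIso (P.ι.map f))
      have h0' : f.hom = 0 := congrArg (fun k => k.hom) h0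
      exact (IsZero.iff_id_eq_zero S).2 ((IsIso.inv_hom_id f.hom).symm.trans
        ((congrArg (inv f.hom ≫ ·) h0').trans comp_zero))
    · have : IsIso (P.ι.map f) :=
        h Y.property f.hom ((mono_iff f).1 hf) fun h' => h0 (ObjectProperty.hom_ext _ h')
      exact isIso_of_reflects_iso f P.ι

lemma simple_fullSubcategory_of_iso (P : ObjectProperty D) {S S' : D} (hS : P S) (hS' : P S')
    (e : S ≅ S') (h : Simple (⟨S, hS⟩ : P.FullSubcategory)) :
    Simple (⟨S', hS'⟩ : P.FullSubcategory) :=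
  Simple.of_iso (P.isoMk (X := ⟨S', hS'⟩) (Y := ⟨S, hS⟩) e.symm)

end Mono

section ShortExact

variable {C : Type u} [Category.{v} C] [Abelian C]

lemma exists_shortExact_pushout {A B M F : C} {f : A ⟶ B} {g : B ⟶ M} {zero : f ≫ g = 0}
    (h : (ShortComplex.mk f g zero).ShortExact) (k : A ⟶ F) :
    ∃ (q : pushout f k ⟶ M) (zero' : pushout.inr f k ≫ q = 0),
      (ShortComplex.mk (pushout.inr f k) q zero').ShortExact := by
  have : Mono f := h.mono_f
  have : Epi g := h.epi_g
  have w : f ≫ g = k ≫ (0 : F ⟶ M) := by rw [zero, comp_zero]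
  have : Epi (pushout.desc g (0 : F ⟶ M) w) := epi_of_epi_fac (pushout.inl_desc g 0 w)
  refine ⟨pushout.desc g 0 w, pushout.inr_desc g 0 w, ⟨?_⟩⟩
  apply ShortComplex.exact_of_g_is_cokernel
  refine CokernelCofork.IsColimit.ofπ' _ _ fun {Z} t ht => ?_
  have hA : f ≫ pushout.inl f k ≫ t = 0 := by
    rw [pushout.condition_assoc, ht, comp_zero]
  refine ⟨h.exact.desc (pushout.inl f k ≫ t) hA, ?_⟩
  apply pushout.hom_ext
  · rw [pushout.inl_desc_assoc]
    exact h.exact.g_desc _ _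
  · rw [pushout.inr_desc_assoc, zero_comp, ht]

lemma shortExact_cokernel {X Y : C} (f : X ⟶ Y) [Mono f] :
    (ShortComplex.mk f (cokernel.π f) (cokernel.condition f)).ShortExact :=
  .mk' (ShortComplex.exact_cokernel f) inferInstance inferInstance

end ShortExact

/-! ### Orthogonality and closure properties of torsion pairs -/

namespace IsTorsionPair

variable {C : Type u} [Category.{v} C] [Abelian C] {T F : ObjectProperty C}

lemma torsion_iff (h : IsTorsionPair T F) (X : C) :
    T X ↔ ∀ ⦃Y : C⦄, F Y → ∀ f : X ⟶ Y, f = 0 := by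
  refine ⟨fun hX Y hY f => h.hom_eq_zero hX hY f, fun hX => ?_⟩
  obtain ⟨A, B, i, p, zero, hS, hA, hB⟩ := h.exists_shortExact X
  have : Mono i := hS.mono_f
  have : Epi i := hS.exact.epi_f (hX hB p)
  have : IsIso i := isIso_of_mono_of_epi i
  have := h.torsion_iso
  exact T.prop_of_iso (asIso i) hA

lemma torsionFree_iff (h : IsTorsionPair T F) (Y : C) :
    F Y ↔ ∀ ⦃X : C⦄, T X → ∀ f : X ⟶ Y, f = 0 := by
  refine ⟨fun hY X hX f => h.hom_eq_zero hX hY f, fun hY => ?_⟩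
  obtain ⟨A, B, i, p, zero, hS, hA, hB⟩ := h.exists_shortExact Y
  have : Epi p := hS.epi_g
  have : Mono p := hS.exact.mono_g (hY hA i)
  have : IsIso p := isIso_of_mono_of_epi p
  have := h.torsionFree_iso
  exact F.prop_of_iso (asIso p).symm hB

lemma torsion_of_epi (h : IsTorsionPair T F) {X Y : C} (f : X ⟶ Y) [Epi f] (hX : T X) : T Y := by
  rw [h.torsion_iff]
  intro Z hZ g
  rw [← cancel_epi f, comp_zero]
  exact h.hom_eq_zero hX hZ _

lemma torsionFree_of_mono (h : IsTorsionPair T F) {X Y : C} (f : X ⟶ Y) [Mono f] (hY : F Y) :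
    F X := by
  rw [h.torsionFree_iff]
  intro Z hZ g
  rw [← cancel_mono f, zero_comp]
  exact h.hom_eq_zero hZ hY _

lemma torsion_of_shortExact (h : IsTorsionPair T F) {S : ShortComplex C} (hS : S.ShortExact)
    (h₁ : T S.X₁) (h₃ : T S.X₃) : T S.X₂ := by
  rw [h.torsion_iff]
  intro Z hZ g
  have : Epi S.g := hS.epi_g
  rw [← hS.exact.g_desc g (h.hom_eq_zero h₁ hZ _), h.hom_eq_zero h₃ hZ (hS.exact.desc g _),
    comp_zero]

lemma torsion_of_isZero (h : IsTorsionPair T F) {X : C} (hX : IsZero X) : T X :=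
  (h.torsion_iff X).2 fun _ _ _ => hX.eq_of_src _ _

lemma torsionFree_of_isZero (h : IsTorsionPair T F) {X : C} (hX : IsZero X) : F X :=
  (h.torsionFree_iff X).2 fun _ _ _ => hX.eq_of_tgt _ _

lemma isZero_of_torsion_of_torsionFree (h : IsTorsionPair T F) {X : C} (h₁ : T X) (h₂ : F X) :
    IsZero X := by
  rw [IsZero.iff_id_eq_zero]
  exact h.hom_eq_zero h₁ h₂ _

end IsTorsionPair

open Pretriangulated DerivedCategory

/-! ### Exactness and shifts of distinguished triangles -/

section Pretriangulated

variable {D : Type u} [Category.{v} D] [Preadditive D] [HasZeroObject D] [HasShift D ℤ]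
  [∀ n : ℤ, (shiftFunctor D n).Additive] [Pretriangulated D]

variable {X Y Z : D} {a : X ⟶ Y} {b : Y ⟶ Z} {d : Z ⟶ X⟦(1 : ℤ)⟧}

lemma exists_factor_mor₁ (hd : Triangle.mk a b d ∈ distTriang D) {W : D} (g : W ⟶ Y)
    (hg : g ≫ b = 0) : ∃ k : W ⟶ X, g = k ≫ a :=
  Triangle.coyoneda_exact₂ _ hd g hg

lemma exists_factor_mor₂ (hd : Triangle.mk a b d ∈ distTriang D) {W : D} (g : Y ⟶ W)
    (hg : a ≫ g = 0) : ∃ k : Z ⟶ W, g = b ≫ k :=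
  Triangle.yoneda_exact₂ _ hd g hg

lemma exists_factor_mor₃ (hd : Triangle.mk a b d ∈ distTriang D) {W : D} (g : Z ⟶ W)
    (hg : b ≫ g = 0) : ∃ k : X⟦(1 : ℤ)⟧ ⟶ W, g = d ≫ k :=
  Triangle.yoneda_exact₃ _ hd g hg

lemma distTriang_invRotate (hd : Triangle.mk a b d ∈ distTriang D) :
    ∃ c : Z⟦(-1 : ℤ)⟧ ⟶ X, ∃ e : Y ⟶ (Z⟦(-1 : ℤ)⟧)⟦(1 : ℤ)⟧, Triangle.mk c a e ∈ distTriang D :=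
  ⟨_, _, inv_rot_of_distTriang _ hd⟩

lemma distTriang_shift (hd : Triangle.mk a b d ∈ distTriang D) (n : ℤ) :
    ∃ e, Triangle.mk (a⟦n⟧') (b⟦n⟧') e ∈ distTriang D := by
  let u : ℤˣ := n.negOnePow
  let d' : Z⟦n⟧ ⟶ (X⟦n⟧)⟦(1 : ℤ)⟧ := u • d⟦n⟧' ≫ (shiftFunctorComm D 1 n).hom.app X
  have key : Triangle.mk (u • a⟦n⟧') (u • b⟦n⟧') d' ∈ distTriang D :=
    Triangle.shift_distinguished _ hd n
  have hu : u * u = 1 := Int.units_mul_self u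
  -- Shifting multiplies all three maps by a sign; the automorphism `u` of the middle term removes
  -- it from the first two.
  let i : Y⟦n⟧ ≅ Y⟦n⟧ := ⟨u • 𝟙 _, u • 𝟙 _, by simp [smul_smul, hu], by simp [smul_smul, hu]⟩
  have h₁ : a⟦n⟧' ≫ i.hom = 𝟙 _ ≫ (u • a⟦n⟧') := by simp [i]
  have h₂ : b⟦n⟧' ≫ 𝟙 _ = i.hom ≫ (u • b⟦n⟧') := by simp [i, smul_smul, hu]
  have h₃ : d' ≫ (𝟙 (X⟦n⟧))⟦(1 : ℤ)⟧' = 𝟙 _ ≫ d' := by simp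
  exact ⟨d', isomorphic_distinguished _ key _
    (Triangle.isoMk _ _ (Iso.refl _) i (Iso.refl _) h₁ h₂ h₃)⟩

lemma distTriang_of_iso (hd : Triangle.mk a b d ∈ distTriang D) {X' Y' Z' : D}
    (e₁ : X' ≅ X) (e₂ : Y' ≅ Y) (e₃ : Z' ≅ Z) :
    Triangle.mk (e₁.hom ≫ a ≫ e₂.inv) (e₂.hom ≫ b ≫ e₃.inv)
      (e₃.hom ≫ d ≫ e₁.inv⟦(1 : ℤ)⟧') ∈ distTriang D := by
  have h₁ : (e₁.hom ≫ a ≫ e₂.inv) ≫ e₂.hom = e₁.hom ≫ a := by simp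
  have h₂ : (e₂.hom ≫ b ≫ e₃.inv) ≫ e₃.hom = e₂.hom ≫ b := by simp
  have h₃ : (e₃.hom ≫ d ≫ e₁.inv⟦(1 : ℤ)⟧') ≫ e₁.hom⟦(1 : ℤ)⟧' = e₃.hom ≫ d := by
    rw [Category.assoc, Category.assoc, ← Functor.map_comp, Iso.inv_hom_id, CategoryTheory.Functor.map_id,
      Category.comp_id]
  exact isomorphic_distinguished _ hd _ (Triangle.isoMk _ _ e₁ e₂ e₃ h₁ h₂ h₃)

/-- A map killed by `a` factors through the preceding term `Z[-1]` of the triangle. -/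
lemma eq_zero_of_comp_mor₁ (hd : Triangle.mk a b d ∈ distTriang D) {W : D}
    (hW : ∀ k : W ⟶ Z⟦(-1 : ℤ)⟧, k = 0) (g : W ⟶ X) (hg : g ≫ a = 0) : g = 0 := by
  obtain ⟨c, e, hc⟩ := distTriang_invRotate hd
  obtain ⟨k, rfl⟩ := exists_factor_mor₁ hc g hg
  rw [hW k, zero_comp]

end Pretriangulated

/-! ### Objects of `C` inside the derived category -/

variable {C : Type u} [Category.{v} C] [Abelian C] [HasDerivedCategory.{w} C]

instance (M : C) : (((singleFunctor C 0).obj M)⟦(-1 : ℤ)⟧).IsLE 1 :=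
  TStructure.t.isLE_shift _ 0 (-1) 1

instance (M : C) : (((singleFunctor C 0).obj M)⟦(-1 : ℤ)⟧).IsGE 1 :=
  TStructure.t.isGE_shift _ 0 (-1) 1

lemma isZero_of_isZero_single {M : C} (h : IsZero ((singleFunctor C 0).obj M)) : IsZero M := by
  rw [IsZero.iff_id_eq_zero] at h ⊢
  exact (singleFunctor C 0).map_injective (by simpa using h)

lemma single_shift_map_injective {M N : C} {f g : M ⟶ N}
    (h : ((singleFunctor C 0).map f)⟦(-1 : ℤ)⟧' = ((singleFunctor C 0).map g)⟦(-1 : ℤ)⟧') :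
    f = g :=
  (singleFunctor C 0).map_injective ((shiftFunctor (DerivedCategory C) (-1 : ℤ)).map_injective h)

lemma single_shift_map_surjective {M N : C}
    (f : ((singleFunctor C 0).obj M)⟦(-1 : ℤ)⟧ ⟶ ((singleFunctor C 0).obj N)⟦(-1 : ℤ)⟧) :
    ∃ g : M ⟶ N, ((singleFunctor C 0).map g)⟦(-1 : ℤ)⟧' = f := by
  obtain ⟨f', rfl⟩ := (shiftFunctor (DerivedCategory C) (-1 : ℤ)).map_surjective f
  obtain ⟨g, rfl⟩ := (singleFunctor C 0).map_surjective f'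
  exact ⟨g, rfl⟩

/-- An extension, in the derived category, of objects concentrated in degree `0` comes from a
short exact sequence. -/
lemma exists_shortExact_of_distTriang {M N : C} {W Y : DerivedCategory C}
    (a : (singleFunctor C 0).obj M ⟶ W) (b : W ⟶ Y)
    (d : Y ⟶ ((singleFunctor C 0).obj M)⟦(1 : ℤ)⟧) (hd : Triangle.mk a b d ∈ distTriang _)
    (e : Y ≅ (singleFunctor C 0).obj N) :
    ∃ (X : C) (_ : W ≅ (singleFunctor C 0).obj X) (f : M ⟶ X) (g : X ⟶ N) (zero : f ≫ g = 0),
      (ShortComplex.mk f g zero).ShortExact := by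
  have hY₁ : Y.IsLE 0 := TStructure.t.isLE_of_iso e.symm 0
  have hY₂ : Y.IsGE 0 := TStructure.t.isGE_of_iso e.symm 0
  have : W.IsLE 0 := TStructure.t.isLE₂ _ hd 0 (inferInstanceAs (((singleFunctor C 0).obj M).IsLE 0)) hY₁
  have : W.IsGE 0 := TStructure.t.isGE₂ _ hd 0 (inferInstanceAs (((singleFunctor C 0).obj M).IsGE 0)) hY₂
  obtain ⟨X, ⟨i⟩⟩ := exists_iso_singleFunctor_obj_of_isGE_of_isLE W 0
  obtain ⟨f, hf⟩ := (singleFunctor C 0).map_surjective (a ≫ i.hom)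
  obtain ⟨g, hg⟩ := (singleFunctor C 0).map_surjective (i.inv ≫ b ≫ e.hom)
  have hd' : Triangle.mk ((singleFunctor C 0).map f) ((singleFunctor C 0).map g)
      (e.inv ≫ d ≫ (𝟙 ((singleFunctor C 0).obj M))⟦(1 : ℤ)⟧') ∈ distTriang _ := by
    rw [hf, hg, ← Category.id_comp (a ≫ i.hom)]
    exact distTriang_of_iso hd (Iso.refl _) i.symm e.symm
  have zero : f ≫ g = 0 := (singleFunctor C 0).map_injective <| by
    rw [Functor.map_comp, Functor.map_zero]
    exact comp_distTriang_mor_zero₁₂ _ hd'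
  have hmono : Mono f := by
    rw [Preadditive.mono_iff_cancel_zero]
    intro Z k hk
    apply (singleFunctor C 0).map_injective
    rw [Functor.map_zero]
    refine eq_zero_of_comp_mor₁ hd' (fun l => TStructure.t.zero l 0 1) _ ?_
    rw [← Functor.map_comp, hk, Functor.map_zero]
  have hepi : Epi g := by
    rw [Preadditive.epi_iff_cancel_zero]
    intro Z k hk
    apply (singleFunctor C 0).map_injective
    rw [Functor.map_zero]
    obtain ⟨l, hl⟩ := exists_factor_mor₃ hd' ((singleFunctor C 0).map k)
      (by rw [← Functor.map_comp, hk, Functor.map_zero])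
    have : (((singleFunctor C 0).obj M)⟦(1 : ℤ)⟧).IsLE (-1) :=
      TStructure.t.isLE_shift _ 0 1 (-1)
    have hl0 : l = 0 := TStructure.t.zero_of_isLE_of_isGE l (-1) 0 (by lia) this inferInstance
    rw [hl, hl0, comp_zero]
  refine ⟨X, i, f, g, zero, ⟨?_⟩⟩
  apply ShortComplex.exact_of_f_is_kernel
  have lift : ∀ {Z : C} (t : Z ⟶ X), t ≫ g = 0 → ∃ l : Z ⟶ M, l ≫ f = t := by
    intro Z t ht
    obtain ⟨l, hl⟩ := exists_factor_mor₁ hd' ((singleFunctor C 0).map t)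
      (by rw [← Functor.map_comp, ht, Functor.map_zero])
    obtain ⟨l, rfl⟩ := (singleFunctor C 0).map_surjective l
    exact ⟨l, (singleFunctor C 0).map_injective (by rw [hl, Functor.map_comp])⟩
  exact KernelFork.IsLimit.ofι' _ _ fun t ht => ⟨(lift t ht).choose, (lift t ht).choose_spec⟩

/-! ### The heart: truncation triangles and vanishing of negative Homs -/

section Heart

variable {T F : ObjectProperty C}

lemma isLE_of_heart {X : DerivedCategory C} (hX : heart T F X) : X.IsLE 1 := by
  have : (X⟦(1 : ℤ)⟧).IsLE 0 := (isLE_iff _ _).2 hX.1.2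
  exact TStructure.t.isLE_of_shift X 1 1 0

lemma isGE_of_heart {X : DerivedCategory C} (hX : heart T F X) : X.IsGE 0 :=
  (isGE_iff _ _).2 hX.2.2

lemma heart_of_iso (h : IsTorsionPair T F) {X Y : DerivedCategory C} (e : X ≅ Y)
    (hX : heart T F X) : heart T F Y := by
  have := h.torsion_iso
  have := h.torsionFree_iso
  exact ⟨⟨T.prop_of_iso ((homologyFunctor C 0).mapIso
      ((shiftFunctor (DerivedCategory C) (1 : ℤ)).mapIso e)) hX.1.1,
    fun i hi => (hX.1.2 i hi).of_iso ((homologyFunctor C i).mapIso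
      ((shiftFunctor (DerivedCategory C) (1 : ℤ)).mapIso e.symm))⟩,
    F.prop_of_iso ((homologyFunctor C 0).mapIso e) hX.2.1,
    fun i hi => (hX.2.2 i hi).of_iso ((homologyFunctor C i).mapIso e.symm)⟩

lemma heart_single (h : IsTorsionPair T F) {M : C} (hM : F M) :
    heart T F ((singleFunctor C 0).obj M) := by
  have := h.torsionFree_iso
  have : (((singleFunctor C 0).obj M)⟦(1 : ℤ)⟧).IsLE (-1) :=
    TStructure.t.isLE_shift _ 0 1 (-1)
  exact ⟨⟨h.torsion_of_isZero (isZero_of_isLE _ (-1) 0 (by lia)),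
    fun i hi => isZero_of_isLE _ (-1) i (by lia)⟩,
    F.prop_of_iso ((singleFunctorCompHomologyFunctorIso C 0).symm.app M) hM,
    fun i hi => isZero_of_isGE _ 0 i hi⟩

lemma heart_single_shift (h : IsTorsionPair T F) {M : C} (hM : T M) :
    heart T F (((singleFunctor C 0).obj M)⟦(-1 : ℤ)⟧) := by
  have := h.torsion_iso
  let e : (((singleFunctor C 0).obj M)⟦(-1 : ℤ)⟧)⟦(1 : ℤ)⟧ ≅ (singleFunctor C 0).obj M :=
    (shiftFunctorCompIsoId (DerivedCategory C) (-1 : ℤ) 1 (by lia)).app _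
  exact ⟨⟨T.prop_of_iso ((singleFunctorCompHomologyFunctorIso C 0).symm.app M ≪≫
      (homologyFunctor C 0).mapIso e.symm) hM,
    fun i hi => (isZero_of_isLE _ 0 i hi).of_iso ((homologyFunctor C i).mapIso e)⟩,
    h.torsionFree_of_isZero (isZero_of_isGE _ 1 0 (by lia)),
    fun i hi => isZero_of_isGE _ 1 i (by lia)⟩

/-- This is the truncation triangle: `X` has cohomology only in degrees `0` and `1`, so `A` is
`H⁰(X)` and `B` is `H¹(X)`. -/
lemma exists_triangle_of_heart (h : IsTorsionPair T F) {X : DerivedCategory C}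
    (hX : heart T F X) :
    ∃ (A B : C) (_ : F A) (_ : T B) (a : (singleFunctor C 0).obj A ⟶ X)
      (b : X ⟶ ((singleFunctor C 0).obj B)⟦(-1 : ℤ)⟧)
      (d : ((singleFunctor C 0).obj B)⟦(-1 : ℤ)⟧ ⟶ ((singleFunctor C 0).obj A)⟦(1 : ℤ)⟧),
      Triangle.mk a b d ∈ distTriang _ := by
  have := h.torsion_iso
  have := h.torsionFree_iso
  have hX₁ := isLE_of_heart hX
  have hX₀ := isGE_of_heart hX
  obtain ⟨X', Y', hX', hY', a, b, d, hd⟩ := TStructure.t.exists_triangle X 0 1 (by lia)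
  have hX'₀ : X'.IsLE 0 := ⟨hX'⟩
  have hY'₁ : Y'.IsGE 1 := ⟨hY'⟩
  have hX'' : X'.IsGE 0 := by
    refine TStructure.t.isGE₂ _ (inv_rot_of_distTriang _ hd) 0 ?_ hX₀
    have : (Y'⟦(-1 : ℤ)⟧).IsGE 2 := TStructure.t.isGE_shift _ 1 (-1) 2
    exact TStructure.t.isGE_of_ge (Y'⟦(-1 : ℤ)⟧) 0 2
  have hY'' : Y'.IsLE 1 := by
    refine TStructure.t.isLE₂ _ (rot_of_distTriang _ hd) 1 hX₁ ?_
    have : (X'⟦(1 : ℤ)⟧).IsLE (-1) := TStructure.t.isLE_shift _ 0 1 (-1)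
    exact TStructure.t.isLE_of_le (X'⟦(1 : ℤ)⟧) (-1) 1
  have hY₃ : (Y'⟦(1 : ℤ)⟧).IsLE 0 := TStructure.t.isLE_shift _ 1 1 0
  have hY₄ : (Y'⟦(1 : ℤ)⟧).IsGE 0 := TStructure.t.isGE_shift _ 1 1 0
  obtain ⟨A, ⟨i⟩⟩ := exists_iso_singleFunctor_obj_of_isGE_of_isLE X' 0
  obtain ⟨B, ⟨j⟩⟩ := exists_iso_singleFunctor_obj_of_isGE_of_isLE (Y'⟦(1 : ℤ)⟧) 0
  let j' : Y' ≅ ((singleFunctor C 0).obj B)⟦(-1 : ℤ)⟧ :=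
    ((shiftFunctorCompIsoId (DerivedCategory C) (1 : ℤ) (-1) (by lia)).app Y').symm ≪≫
      (shiftFunctor (DerivedCategory C) (-1 : ℤ)).mapIso j
  have hA : F A := by
    have hepi : Epi ((homologyFunctor C 0).map a) :=
      (HomologySequence.epi_homologyMap_mor₁_iff _ hd 0).2
        ((isZero_of_isGE Y' 1 0 (by lia)).eq_of_tgt _ _)
    have hmono : Mono ((homologyFunctor C 0).map a) :=
      (HomologySequence.mono_homologyMap_mor₁_iff _ hd (-1) 0 (by lia)).2
        ((isZero_of_isGE Y' 1 (-1) (by lia)).eq_of_src _ _)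
    have := isIso_of_mono_of_epi ((homologyFunctor C 0).map a)
    exact F.prop_of_iso ((asIso ((homologyFunctor C 0).map a)).symm ≪≫
      (homologyFunctor C 0).mapIso i ≪≫ (singleFunctorCompHomologyFunctorIso C 0).app A) hX.2.1
  have hB : T B := by
    have hs := Triangle.shift_distinguished _ hd 1
    have : (X'⟦(1 : ℤ)⟧).IsLE (-1) := TStructure.t.isLE_shift _ 0 1 (-1)
    let m : X⟦(1 : ℤ)⟧ ⟶ Y'⟦(1 : ℤ)⟧ := ((Triangle.shiftFunctor _ 1).obj (Triangle.mk a b d)).mor₂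
    have hepi : Epi ((homologyFunctor C 0).map m) :=
      (HomologySequence.epi_homologyMap_mor₂_iff _ hs 0 1 (by lia)).2
        ((isZero_of_isLE (X'⟦(1 : ℤ)⟧) (-1) 1 (by lia)).eq_of_tgt _ _)
    have hmono : Mono ((homologyFunctor C 0).map m) :=
      (HomologySequence.mono_homologyMap_mor₂_iff _ hs 0).2
        ((isZero_of_isLE (X'⟦(1 : ℤ)⟧) (-1) 0 (by lia)).eq_of_src _ _)
    have := isIso_of_mono_of_epi ((homologyFunctor C 0).map m)
    exact T.prop_of_iso (asIso ((homologyFunctor C 0).map m) ≪≫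
      (homologyFunctor C 0).mapIso j ≪≫ (singleFunctorCompHomologyFunctorIso C 0).app B) hX.1.1
  exact ⟨A, B, hA, hB, _, _, _, distTriang_of_iso hd i.symm (Iso.refl X) j'.symm⟩

/-- Degrees rule out every component of `k` except one `B[-1] ⟶ A'[-1]`, which comes from a map from
a torsion to a torsion-free object. -/
lemma heart_hom_shift_eq_zero (h : IsTorsionPair T F) {X Y : DerivedCategory C}
    (hX : heart T F X) (hY : heart T F Y) (k : X ⟶ Y⟦(-1 : ℤ)⟧) : k = 0 := by
  obtain ⟨A, B, hA, hB, a, b, d, hd⟩ := exists_triangle_of_heart h hX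
  obtain ⟨A', B', hA', hB', a', b', d', hd'⟩ := exists_triangle_of_heart h hY
  obtain ⟨e', hs⟩ := distTriang_shift hd' (-1)
  have := isLE_of_heart hX
  have : ((((singleFunctor C 0).obj B')⟦(-1 : ℤ)⟧)⟦(-1 : ℤ)⟧).IsGE 2 :=
    TStructure.t.isGE_shift _ 1 (-1) 2
  obtain ⟨k', rfl⟩ := exists_factor_mor₁ hs k (TStructure.t.zero _ 1 2)
  obtain ⟨k'', rfl⟩ := exists_factor_mor₂ hd k' (TStructure.t.zero _ 0 1)
  obtain ⟨g, rfl⟩ := single_shift_map_surjective k''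
  rw [h.hom_eq_zero hB hA' g, Functor.map_zero, Functor.map_zero, comp_zero, zero_comp]

/-- A morphism whose cone lies in the heart is a monomorphism relative to the heart. -/
lemma isMonoOn_heart_of_distTriang (h : IsTorsionPair T F) {X Y Z : DerivedCategory C}
    {a : X ⟶ Y} {b : Y ⟶ Z} {d : Z ⟶ X⟦(1 : ℤ)⟧} (hd : Triangle.mk a b d ∈ distTriang _)
    (hZ : heart T F Z) : IsMonoOn (heart T F) a :=
  fun _ hW g hg => eq_zero_of_comp_mor₁ hd (heart_hom_shift_eq_zero h hW hZ) g hg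

end Heart

/-! ### Monomorphisms of the heart from maps in `C` -/

section HeartMono

variable {C : Type u} [Category.{v} C] [Abelian C] [HasDerivedCategory.{w} C]
  {T F : ObjectProperty C}

lemma distTriang_single {X Y Z : C} {f : X ⟶ Y} {g : Y ⟶ Z} {zero : f ≫ g = 0}
    (hS : (ShortComplex.mk f g zero).ShortExact) :
    ∃ d, Triangle.mk ((singleFunctor C 0).map f) ((singleFunctor C 0).map g) d ∈ distTriang _ :=
  ⟨_, hS.singleTriangle_distinguished⟩

/-- The obstruction to cancelling is a map `W ⟶ X[-1]`, which vanishes since `X` lies in the heart.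
-/
lemma isMonoOn_heart_single_shift_map (h : IsTorsionPair T F) {X Y Z : C} {f : X ⟶ Y} {g : Y ⟶ Z}
    {zero : f ≫ g = 0} (hS : (ShortComplex.mk f g zero).ShortExact) (hX : F X) :
    IsMonoOn (heart T F) (((singleFunctor C 0).map g)⟦(-1 : ℤ)⟧') := by
  intro W hW k hk
  obtain ⟨d, hd⟩ := distTriang_single hS
  obtain ⟨e, he⟩ := distTriang_shift hd (-1)
  obtain ⟨l, rfl⟩ := exists_factor_mor₁ he k hk
  rw [heart_hom_shift_eq_zero h hW (heart_single h hX) l, zero_comp]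

/-- Holds for degree reasons alone, so neither `X` nor `Y` need be torsion: the obstruction lands in
`(cokernel f)[-2]`, concentrated in degree `2`. -/
lemma isMonoOn_heart_single_shift_map_of_mono {X Y : C} (f : X ⟶ Y) [Mono f] :
    IsMonoOn (heart T F) (((singleFunctor C 0).map f)⟦(-1 : ℤ)⟧') := by
  intro W hW k hk
  obtain ⟨d, hd⟩ := distTriang_single (shortExact_cokernel f)
  obtain ⟨e, he⟩ := distTriang_shift hd (-1)
  have := isLE_of_heart hW
  have : ((((singleFunctor C 0).obj (cokernel f))⟦(-1 : ℤ)⟧)⟦(-1 : ℤ)⟧).IsGE 2 :=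
    TStructure.t.isGE_shift _ 1 (-1) 2
  exact eq_zero_of_comp_mor₁ he (fun l => TStructure.t.zero l 1 2) k hk

lemma isIso_of_isIso_single_shift_map {X Y : C} (f : X ⟶ Y)
    (h : IsIso (((singleFunctor C 0).map f)⟦(-1 : ℤ)⟧')) : IsIso f := by
  have := isIso_of_reflects_iso ((singleFunctor C 0).map f)
    (shiftFunctor (DerivedCategory C) (-1 : ℤ))
  exact isIso_of_reflects_iso f (singleFunctor C 0)

lemma single_map_ne_zero {X Y : C} {f : X ⟶ Y} (h : f ≠ 0) : (singleFunctor C 0).map f ≠ 0 :=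
  fun h' => h ((singleFunctor C 0).map_injective (by rw [h', Functor.map_zero]))

lemma single_shift_map_ne_zero {X Y : C} {f : X ⟶ Y} (h : f ≠ 0) :
    ((singleFunctor C 0).map f)⟦(-1 : ℤ)⟧' ≠ 0 :=
  fun h' => h (single_shift_map_injective (by rw [h', Functor.map_zero, Functor.map_zero]))

lemma isIso_mor₂_of_mor₁_eq_zero (h : IsTorsionPair T F)
    {N B : C} (hN : F N) (hB : T B) {X : DerivedCategory C}
    {a : (singleFunctor C 0).obj N ⟶ X} {b : X ⟶ ((singleFunctor C 0).obj B)⟦(-1 : ℤ)⟧}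
    {d : ((singleFunctor C 0).obj B)⟦(-1 : ℤ)⟧ ⟶ ((singleFunctor C 0).obj N)⟦(1 : ℤ)⟧}
    (hd : Triangle.mk a b d ∈ distTriang _) (ha : a = 0) : IsIso b := by
  refine (Triangle.isZero₁_iff_isIso₂ _ hd).1 ((IsZero.iff_id_eq_zero _).2 ?_)
  exact isMonoOn_heart_of_distTriang h hd (heart_single_shift h hB) (heart_single h hN)
    (𝟙 _) (by rw [ha, comp_zero])

end HeartMono

/-! ### What simplicity forces on short exact sequences -/

section SimpleSingle

variable {C : Type u} [Category.{v} C] [Abelian C] [HasDerivedCategory.{w} C]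
  {T F : ObjectProperty C} {M : C}

/-- The kernel and coimage of `g` are torsion-free, so `kernel g ⟶ M` is a non-zero subobject in the
heart, hence all of `M`. -/
lemma eq_zero_of_simple_single (h : IsTorsionPair T F) (hM : F M)
    (hs : ∀ ⦃Y : DerivedCategory C⦄, heart T F Y → ∀ f : Y ⟶ (singleFunctor C 0).obj M,
      IsMonoOn (heart T F) f → f ≠ 0 → IsIso f)
    {N : C} (hN : F N) (g : M ⟶ N) (hg : kernel.ι g ≠ 0) : g = 0 := by
  have hK : F (kernel g) := h.torsionFree_of_mono (kernel.ι g) hM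
  have hQ : F (cokernel (kernel.ι g)) :=
    h.torsionFree_of_mono (Abelian.factorThruCoimage g) hN
  obtain ⟨d, hd⟩ := distTriang_single (shortExact_cokernel (kernel.ι g))
  have := hs (heart_single h hK) _ (isMonoOn_heart_of_distTriang h hd (heart_single h hQ))
    (single_map_ne_zero hg)
  have := isIso_of_reflects_iso (kernel.ι g) (singleFunctor C 0)
  rw [← cancel_epi (kernel.ι g), kernel.condition, comp_zero]

/-- A torsion subobject `N` of `Y` gives a monomorphism `N[-1] ⟶ Y[-1] ⟶ M`; were it non-zero, `M`
would sit in degree `1` as well as `0`. -/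
lemma torsionFree_of_simple_single (h : IsTorsionPair T F) (hM0 : ¬ IsZero M)
    (hs : ∀ ⦃Y : DerivedCategory C⦄, heart T F Y → ∀ f : Y ⟶ (singleFunctor C 0).obj M,
      IsMonoOn (heart T F) f → f ≠ 0 → IsIso f)
    {X Y : C} {f : M ⟶ X} {g : X ⟶ Y} {zero : f ≫ g = 0}
    (hS : (ShortComplex.mk f g zero).ShortExact) (hX : F X) : F Y := by
  obtain ⟨d, hd⟩ := distTriang_single hS
  obtain ⟨c, e, hc⟩ := distTriang_invRotate hd
  have hcm := isMonoOn_heart_of_distTriang h hc (heart_single h hX)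
  have key : ∀ {N : C}, T N → ∀ k : N ⟶ Y, Mono k → k = 0 := by
    intro N hN k hk
    have hq : IsMonoOn (heart T F) (((singleFunctor C 0).map k)⟦(-1 : ℤ)⟧' ≫ c) := by
      intro W hW l hl
      exact isMonoOn_heart_single_shift_map_of_mono k hW l
        (hcm hW _ ((Category.assoc _ _ _).trans hl))
    by_contra hk0
    have := hs (heart_single_shift h hN) _ hq
      fun h0 => single_shift_map_ne_zero hk0 (hcm (heart_single_shift h hN) _ h0)
    have : ((singleFunctor C 0).obj M).IsGE 1 :=
      TStructure.t.isGE_of_iso (asIso (((singleFunctor C 0).map k)⟦(-1 : ℤ)⟧' ≫ c)) 1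
    exact hM0 (isZero_of_isZero_single (TStructure.t.isZero _ 0 1))
  rw [h.torsionFree_iff]
  intro N hN k
  rw [← image.fac k, key (h.torsion_of_epi (factorThruImage k) hN) (image.ι k) inferInstance,
    comp_zero]

lemma epi_of_simple_single_shift (h : IsTorsionPair T F)
    (hs : ∀ ⦃Y : DerivedCategory C⦄, heart T F Y →
      ∀ f : Y ⟶ ((singleFunctor C 0).obj M)⟦(-1 : ℤ)⟧,
        IsMonoOn (heart T F) f → f ≠ 0 → IsIso f)
    {N : C} (hN : T N) (g : N ⟶ M) (hg : g ≠ 0) : Epi g := by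
  have h0 : image.ι g ≠ 0 := fun h0 => hg (by rw [← image.fac g, h0, comp_zero])
  have := isIso_of_isIso_single_shift_map _
    (hs (heart_single_shift h (h.torsion_of_epi (factorThruImage g) hN)) _
      (isMonoOn_heart_single_shift_map_of_mono (image.ι g)) (single_shift_map_ne_zero h0))
  rw [← image.fac g]
  infer_instance

lemma torsion_of_simple_single_shift (h : IsTorsionPair T F) (hM0 : ¬ IsZero M)
    (hs : ∀ ⦃Y : DerivedCategory C⦄, heart T F Y →
      ∀ f : Y ⟶ ((singleFunctor C 0).obj M)⟦(-1 : ℤ)⟧,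
        IsMonoOn (heart T F) f → f ≠ 0 → IsIso f)
    {X Y : C} {f : X ⟶ Y} {g : Y ⟶ M} {zero : f ≫ g = 0}
    (hS : (ShortComplex.mk f g zero).ShortExact) (hY : T Y) : T X := by
  rw [h.torsion_iff]
  intro N hN k
  have hI : F (image k) := h.torsionFree_of_mono (image.ι k) hN
  -- Pushing out makes the kernel torsion-free while the middle term stays torsion, as a quotient of
  -- `Y`. Then `q[-1]` is a non-zero monomorphism, so `q` is invertible and `image k` vanishes.
  obtain ⟨q, hq, hP⟩ := exists_shortExact_pushout hS (factorThruImage k)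
  have hPT : T (pushout f (factorThruImage k)) :=
    h.torsion_of_epi (pushout.inl f (factorThruImage k)) hY
  have : Epi q := hP.epi_g
  have : Mono (pushout.inr f (factorThruImage k)) := hP.mono_f
  have hne : q ≠ 0 := by
    intro h0
    apply hM0
    rw [IsZero.iff_id_eq_zero, ← cancel_epi q, h0, zero_comp, zero_comp]
  have := isIso_of_isIso_single_shift_map _
    (hs (heart_single_shift h hPT) _ (isMonoOn_heart_single_shift_map h hP hI)
      (single_shift_map_ne_zero hne))
  have hinr : pushout.inr f (factorThruImage k) = 0 := by
    rw [← cancel_mono q, hq, zero_comp]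
  have hz : factorThruImage k = 0 := by
    rw [← cancel_mono (pushout.inr f (factorThruImage k)), hinr, comp_zero, comp_zero]
  rw [← image.fac k, hz, zero_comp]

end SimpleSingle

/-! ### Simple objects are of the two types -/

section Forward

variable {A : Type u} [Ring A] [HasDerivedCategory.{w} (ModuleCat.{v} A)]
  {T F : ObjectProperty (ModuleCat.{v} A)} {M : ModuleCat.{v} A}

lemma isAlmostTorsion_of_simple (h : IsTorsionPair T F) (hM : F M)
    (hs : Simple (⟨(singleFunctor (ModuleCat.{v} A) 0).obj M, heart_single h hM⟩ :
      (heart T F).FullSubcategory)) : IsAlmostTorsion T F M := by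
  rw [simple_fullSubcategory_iff] at hs
  obtain ⟨h0, hs⟩ := hs
  have hM0 : ¬ IsZero M := fun hz => h0 ((singleFunctor _ 0).map_isZero hz)
  refine ⟨?_, fun N hN => ?_, fun X Y f g zero hS hX =>
    torsionFree_of_simple_single h hM0 hs hS hX⟩
  · rwa [ModuleCat.isZero_iff_subsingleton, not_subsingleton_iff_nontrivial] at hM0
  · rw [h.torsion_iff]
    intro Y hY k
    let p : M ⟶ ModuleCat.of A (M ⧸ N) := ModuleCat.ofHom N.mkQ
    have : Epi p := (ModuleCat.epi_iff_surjective _).2 N.mkQ_surjective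
    rw [← cancel_epi p, comp_zero]
    refine eq_zero_of_simple_single h hM hs hY _ fun hk => hN ?_
    let i : ModuleCat.of A N ⟶ M := ModuleCat.ofHom N.subtype
    have hip : i ≫ p = 0 := by
      ext x
      simp [i, p]
    have hi : i = 0 := by
      rw [← kernel.lift_ι (p ≫ k) i (by rw [reassoc_of% hip, zero_comp]), hk, comp_zero]
    rw [Submodule.eq_bot_iff]
    intro x hx
    exact congrArg (fun l : ModuleCat.of A N ⟶ M => l.hom ⟨x, hx⟩) hi

lemma isAlmostTorsionFree_of_simple (h : IsTorsionPair T F) (hM : T M)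
    (hs : Simple (⟨((singleFunctor (ModuleCat.{v} A) 0).obj M)⟦(-1 : ℤ)⟧,
      heart_single_shift h hM⟩ : (heart T F).FullSubcategory)) : IsAlmostTorsionFree T F M := by
  rw [simple_fullSubcategory_iff] at hs
  obtain ⟨h0, hs⟩ := hs
  have hM0 : ¬ IsZero M := fun hz =>
    h0 (Functor.map_isZero (shiftFunctor _ (-1 : ℤ)) ((singleFunctor _ 0).map_isZero hz))
  refine ⟨?_, fun N hN => ?_, fun X Y f g zero hS hX =>
    torsion_of_simple_single_shift h hM0 hs hS hX⟩
  · rwa [ModuleCat.isZero_iff_subsingleton, not_subsingleton_iff_nontrivial] at hM0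
  · rw [h.torsionFree_iff]
    intro Y hY k
    let i : ModuleCat.of A N ⟶ M := ModuleCat.ofHom N.subtype
    have : Mono i := (ModuleCat.mono_iff_injective _).2 N.subtype_injective
    rw [← cancel_mono i, zero_comp]
    by_contra hk
    have := epi_of_simple_single_shift h hs hY _ hk
    have : Epi i := epi_of_epi k i
    exact hN (Submodule.range_subtype N ▸
      LinearMap.range_eq_top.2 ((ModuleCat.epi_iff_surjective i).1 inferInstance))

lemma exists_iso_of_simple (h : IsTorsionPair T F) {S : DerivedCategory (ModuleCat.{v} A)}
    (hS : heart T F S) (hs : Simple (⟨S, hS⟩ : (heart T F).FullSubcategory)) :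
    (∃ M : ModuleCat.{v} A, T M ∧ IsAlmostTorsionFree T F M ∧
        Nonempty (S ≅ ((singleFunctor (ModuleCat.{v} A) 0).obj M)⟦(-1 : ℤ)⟧)) ∨
      (∃ M : ModuleCat.{v} A, F M ∧ IsAlmostTorsion T F M ∧
        Nonempty (S ≅ (singleFunctor (ModuleCat.{v} A) 0).obj M)) := by
  obtain ⟨N, B, hN, hB, a, b, d, hd⟩ := exists_triangle_of_heart h hS
  by_cases ha : a = 0
  · have := isIso_mor₂_of_mor₁_eq_zero h hN hB hd ha
    exact .inl ⟨B, hB, isAlmostTorsionFree_of_simple h hB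
      (simple_fullSubcategory_of_iso _ hS _ (asIso b) hs), ⟨asIso b⟩⟩
  · have := ((simple_fullSubcategory_iff _ _ _).1 hs).2 (heart_single h hN) a
      (isMonoOn_heart_of_distTriang h hd (heart_single_shift h hB)) ha
    exact .inr ⟨N, hN, isAlmostTorsion_of_simple h hN
      (simple_fullSubcategory_of_iso _ hS _ (asIso a).symm hs), ⟨(asIso a).symm⟩⟩

end Forward

/-! ### The two types are simple -/

section Converse

variable {C : Type u} [Category.{v} C] [Abelian C] [HasDerivedCategory.{w} C]
  {T F : ObjectProperty C} {M : C}

lemma simple_single (h : IsTorsionPair T F) (hM : F M) (hM0 : ¬ IsZero M)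
    (hquot : ∀ ⦃N : C⦄ (k : N ⟶ M), k ≠ 0 → T (cokernel k))
    (hcoker : ∀ ⦃X Y : C⦄ (f : M ⟶ X) (g : X ⟶ Y) (zero : f ≫ g = 0),
      (ShortComplex.mk f g zero).ShortExact → F X → F Y) :
    Simple (⟨(singleFunctor C 0).obj M, heart_single h hM⟩ : (heart T F).FullSubcategory) := by
  rw [simple_fullSubcategory_iff]
  refine ⟨fun hz => hM0 (isZero_of_isZero_single hz), fun Y hY f hf hf0 => ?_⟩
  obtain ⟨A, B, hA, hB, a, b, d, hd⟩ := exists_triangle_of_heart h hY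
  obtain ⟨k, hk⟩ := (singleFunctor C 0).map_surjective (a ≫ f)
  have ham := isMonoOn_heart_of_distTriang h hd (heart_single_shift h hB)
  have : Mono k := by
    refine Preadditive.mono_of_kernel_zero ?_
    have hK := heart_single h (h.torsionFree_of_mono (kernel.ι k) hA)
    refine (singleFunctor C 0).map_injective ?_
    rw [Functor.map_zero]
    refine ham hK _ (hf hK _ ?_)
    rw [Category.assoc, ← hk, ← Functor.map_comp, kernel.condition, Functor.map_zero]
  obtain ⟨d', hd'⟩ := distTriang_single (shortExact_cokernel k)
  obtain ⟨W, p, w, hw⟩ := distinguished_cocone_triangle f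
  -- Comparing the cones of `a`, `f` and `a ≫ f` exhibits the cone `W` of `f` as an extension of `B`
  -- by `cokernel k`.
  let oct := Triangulated.someOctahedron hk.symm hd hw hd'
  obtain ⟨X, i, u, v, zero, hS⟩ := exists_shortExact_of_distTriang (N := B) (W := W) _ _ _
    (rot_of_distTriang _ oct.mem)
    ((shiftFunctorCompIsoId (DerivedCategory C) (-1 : ℤ) 1 (by lia)).app _)
  have hX : F X := by
    obtain ⟨c, e, hc⟩ := distTriang_invRotate hw
    have hcm := isMonoOn_heart_of_distTriang h hc (heart_single h hM)
    have hcf : c ≫ f = 0 := comp_distTriang_mor_zero₁₂ _ hc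
    rw [h.torsionFree_iff]
    intro N hN n
    have hN' := heart_single_shift h hN
    -- Both `c : W[-1] ⟶ Y` and `f` can be cancelled, yet `c ≫ f = 0`.
    have h0 : ((singleFunctor C 0).map n ≫ i.inv)⟦(-1 : ℤ)⟧' = 0 :=
      hcm hN' _ (hf hN' _ (by rw [Category.assoc, hcf, comp_zero]))
    have h1 : (singleFunctor C 0).map n ≫ i.inv = 0 :=
      (shiftFunctor (DerivedCategory C) (-1 : ℤ)).map_injective (by rw [h0, Functor.map_zero])
    apply (singleFunctor C 0).map_injective
    rw [Functor.map_zero, ← cancel_mono i.inv, h1, zero_comp]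
  -- If `k = 0`, then `A = 0` and `X` is an extension of `B` by `M`, so `B` is torsion-free too and
  -- `Y = 0`.
  by_cases hk0 : k = 0
  · exfalso
    have hπ : IsIso (cokernel.π k) := by
      subst hk0
      infer_instance
    have zero' : (cokernel.π k ≫ u) ≫ v = 0 := by rw [Category.assoc, zero, comp_zero]
    let e : ShortComplex.mk u v zero ≅ ShortComplex.mk (cokernel.π k ≫ u) v zero' :=
      ShortComplex.isoMk (asIso (cokernel.π k)).symm (Iso.refl X) (Iso.refl B)
        (by simp) (by simp)
    have hS' := ShortComplex.shortExact_of_iso e hS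
    have hBz := h.isZero_of_torsion_of_torsionFree hB (hcoker _ _ _ hS' hX)
    have hAz : a = 0 := by
      have : IsZero A := (IsZero.iff_id_eq_zero A).2 (by
        rw [← cancel_mono k, hk0, comp_zero, comp_zero])
      exact ((singleFunctor C 0).map_isZero this).eq_of_src _ _
    have := isIso_mor₂_of_mor₁_eq_zero h hA hB hd hAz
    have hYz : IsZero Y := (Functor.map_isZero (shiftFunctor (DerivedCategory C) (-1 : ℤ))
      ((singleFunctor C 0).map_isZero hBz)).of_iso (asIso b)
    exact hf0 (hYz.eq_of_src _ _)
  · have hXz := h.isZero_of_torsion_of_torsionFree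
      (h.torsion_of_shortExact hS (hquot k hk0) hB) hX
    exact (Triangle.isZero₃_iff_isIso₁ _ hw).1 (((singleFunctor C 0).map_isZero hXz).of_iso i)

lemma simple_single_shift (h : IsTorsionPair T F) (hM : T M) (hM0 : ¬ IsZero M)
    (hsub : ∀ ⦃N : C⦄ (g : N ⟶ M), ¬ Epi g → F (image g))
    (hker : ∀ ⦃X Y : C⦄ (f : X ⟶ Y) (g : Y ⟶ M) (zero : f ≫ g = 0),
      (ShortComplex.mk f g zero).ShortExact → T Y → T X) :
    Simple (⟨((singleFunctor C 0).obj M)⟦(-1 : ℤ)⟧, heart_single_shift h hM⟩ :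
      (heart T F).FullSubcategory) := by
  rw [simple_fullSubcategory_iff]
  refine ⟨fun hz => hM0 ?_, fun Y hY f hf hf0 => ?_⟩
  · rw [IsZero.iff_id_eq_zero]
    exact single_shift_map_injective (hz.eq_of_src _ _)
  obtain ⟨A, B, hA, hB, a, b, d, hd⟩ := exists_triangle_of_heart h hY
  -- `A` is in degree `0` and the target in degree `1`, so `a ≫ f = 0`.
  have ha : a = 0 := hf (heart_single h hA) a (TStructure.t.zero _ 0 1)
  have := isIso_mor₂_of_mor₁_eq_zero h hA hB hd ha
  obtain ⟨g, hg⟩ := single_shift_map_surjective (inv b ≫ f)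
  obtain rfl : f = b ≫ ((singleFunctor C 0).map g)⟦(-1 : ℤ)⟧' := by simp [hg]
  have : Epi g := by
    by_contra hne
    have h0 := h.hom_eq_zero hB (hsub g hne) (factorThruImage g)
    apply hf0
    rw [← image.fac g, h0, zero_comp, Functor.map_zero, Functor.map_zero, comp_zero]
  have hS : (ShortComplex.mk (kernel.ι g) g (kernel.condition g)).ShortExact :=
    .mk' (ShortComplex.exact_kernel g) inferInstance inferInstance
  have : Mono g := by
    refine Preadditive.mono_of_kernel_zero (single_shift_map_injective ?_)
    have h0 := hf (heart_single_shift h (hker _ _ _ hS hB))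
      (((singleFunctor C 0).map (kernel.ι g))⟦(-1 : ℤ)⟧' ≫ inv b) (by
        rw [Category.assoc, IsIso.inv_hom_id_assoc, ← Functor.map_comp, ← Functor.map_comp,
          kernel.condition, Functor.map_zero, Functor.map_zero])
    rw [← cancel_mono (inv b), h0, Functor.map_zero, Functor.map_zero, zero_comp]
  have := isIso_of_mono_of_epi g
  infer_instance

end Converse

/-! ### Submodules and quotients as images and cokernels -/

section Modules

variable {A : Type u} [Ring A] {T F : ObjectProperty (ModuleCat.{v} A)} {M : ModuleCat.{v} A}

lemma IsAlmostTorsion.torsion_cokernel (h : IsTorsionPair T F) (hM : IsAlmostTorsion T F M)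
    {N : ModuleCat.{v} A} (k : N ⟶ M) (hk : k ≠ 0) : T (Limits.cokernel k) := by
  have := h.torsion_iso
  refine T.prop_of_iso (ModuleCat.cokernelIsoRangeQuotient k).symm
    (hM.proper_quotient _ fun hr => hk ?_)
  exact ModuleCat.hom_ext (LinearMap.range_eq_bot.1 hr)

lemma IsAlmostTorsionFree.torsionFree_image (h : IsTorsionPair T F)
    (hM : IsAlmostTorsionFree T F M) {N : ModuleCat.{v} A} (g : N ⟶ M) (hg : ¬ Epi g) :
    F (image g) := by
  have := h.torsionFree_iso
  refine F.prop_of_iso (ModuleCat.imageIsoRange g).symm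
    (hM.proper_submodule _ fun hr => hg ?_)
  exact (ModuleCat.epi_iff_surjective g).2 (LinearMap.range_eq_top.1 hr)

end Modules

end HRS

/-- Right `R`-modules are encoded as left modules over `Rᵐᵒᵖ`. -/
theorem theorem3p5 {R : Type u} [Ring R] [HasDerivedCategory.{w} (ModuleCat.{v} Rᵐᵒᵖ)]
    (T F : ObjectProperty (ModuleCat.{v} Rᵐᵒᵖ)) (hTF : HRS.IsTorsionPair T F)
    (S : DerivedCategory (ModuleCat.{v} Rᵐᵒᵖ)) :
    (∃ hS : HRS.heart T F S, Simple (⟨S, hS⟩ : (HRS.heart T F).FullSubcategory)) ↔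
      (∃ M : ModuleCat.{v} Rᵐᵒᵖ, T M ∧ HRS.IsAlmostTorsionFree T F M ∧
        Nonempty (S ≅ ((DerivedCategory.singleFunctor (ModuleCat.{v} Rᵐᵒᵖ) 0).obj M)⟦(-1 : ℤ)⟧)) ∨
      (∃ M : ModuleCat.{v} Rᵐᵒᵖ, F M ∧ HRS.IsAlmostTorsion T F M ∧
        Nonempty (S ≅ (DerivedCategory.singleFunctor (ModuleCat.{v} Rᵐᵒᵖ) 0).obj M)) := by
  have not_isZero : ∀ M : ModuleCat.{v} Rᵐᵒᵖ, Nontrivial M → ¬ IsZero M := fun M hM => by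
    rwa [ModuleCat.isZero_iff_subsingleton, not_subsingleton_iff_nontrivial]
  constructor
  · rintro ⟨hS, hs⟩
    exact HRS.exists_iso_of_simple hTF hS hs
  · rintro (⟨M, hM, hM', ⟨e⟩⟩ | ⟨M, hM, hM', ⟨e⟩⟩)
    · have hS := HRS.heart_of_iso hTF e.symm (HRS.heart_single_shift hTF hM)
      exact ⟨hS, HRS.simple_fullSubcategory_of_iso _ _ hS e.symm
        (HRS.simple_single_shift hTF hM (not_isZero M hM'.nontrivial)
          (fun _ g => hM'.torsionFree_image hTF g) hM'.kernel)⟩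
    · have hS := HRS.heart_of_iso hTF e.symm (HRS.heart_single hTF hM)
      exact ⟨hS, HRS.simple_fullSubcategory_of_iso _ _ hS e.symm
        (HRS.simple_single hTF hM (not_isZero M hM'.nontrivial)
          (fun _ k => hM'.torsion_cokernel hTF k) hM'.cokernel)⟩
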